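/- **Setting.** Let $\boldsymbol\alpha=(\alpha_1,\dots,\alpha_{n_0})\in\mathbb C^{n_0}$ with $n_0\ge 1$, let $\lambda\in\ell_1(\mathbb Z)$ (complex-valued), let $m\ge 2$ be an integer and let $m_0\ge 2$ be an even integer. For a scalar $s$ write $\boldsymbol\alpha/s=(\alpha_1/s,\dots,\alpha_{n_0}/s)$. Let $\beta^+_{\boldsymbol\alpha}$ be the causal exponential B-spline, i.e. the function with Fourier transform $\prod_{j=1}^{n_0}\frac{1-e^{\alpha_j-\mathrm i\omega}}{\mathrm i\omega-\alpha_j}$: the convolution of the functions $e^{\alpha_j t}\mathbf 1_{[0,1)}(t)$, $j=1,\dots,n_0$. Put $\beta_{\boldsymbol\alpha}(t)=\beta^+_{\boldsymbol\alpha}(t+n_0/2)$ and $$\phi_{\lambda,\boldsymbol\alpha}(t)=\sum_{n\in\mathbb Z}\lambda[n]\,\beta_{\boldsymbol\alpha}(t-n/2),\qquad \phi^+_{\lambda,\boldsymbol\alpha}(t)=\phi_{\lambda,\boldsymbol\alpha}(t-(n_0-1)).$$ Let $h_{\boldsymbol\alpha,m}$ and $g_{\lambda,\boldsymbol\alpha,m_0}$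 be the digital filters with discrete Fourier transforms (in the convention $\sum_k a[k]e^{-\mathrm i\omega k}$) $$H_{\boldsymbol\alpha,m}(e^{\mathrm i\omega})=\frac1{m^{n_0-1}}\prod_{j=1}^{n_0}\sum_{k=0}^{m-1}e^{\alpha_jk}e^{-\mathrm ik\omega},\qquad G_{\lambda,\boldsymbol\alpha,m_0}(e^{\mathrm i\omega})=e^{-\mathrm i\omega m_0(n_0/2-1)}\Big(\sum_{n\in\mathbb Z}\lambda[n]e^{-\mathrm i\omega nm_0/2}\Big)H_{\boldsymbol\alpha,m_0}(e^{\mathrm i\omega}).$$ Write $c_{\uparrow m}$ for upsampling: $c_{\uparrow m}[mn]=c[n]$, and $c_{\uparrow m}[k]=0$ if $m\nmid k$. The *scheme started from a sequence* $c:\mathbb Z\to\mathbb C$ is $$c_0=g_{\lambda,\boldsymbol\alpha/m_0,m_0}*c_{\uparrow m_0},\qquad c_n=h_{\boldsymbol\alpha/(m_0m^n),\,m}*(c_{n-1})_{\uparrow m}\quad(n\ge1).$$ We say that it *converges to* a locally integrable function $u$ if $$\lim_{n\to\infty}\sum_{k\in\mathbb Z}c_n[k]\,\delta(m_0m^nt-k)=u(t)$$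 in the sense of distributions, i.e. $\frac1{m_0m^n}\sum_kc_n[k]\,\psi\big(\tfrac k{m_0m^n}\big)\to\int u\psi$ for every smooth compactly supported $\psi$, and if moreover, whenever $\sum_k|c[k]||\lambda[j-2k]|$ grows at most polynomially in $j\in\mathbb Z$, this holds in the sense of tempered distributions, i.e. for every Schwartz function $\psi$, with absolutely convergent sums and integrals. **Claim.** Let $f$ lie in the span of the integer shifts of $\phi^+_{\lambda,\boldsymbol\alpha}$, in the sense that $f(t)=\sum_{k\in\mathbb Z}a[k]\,\phi^+_{\lambda,\boldsymbol\alpha}(t-k)$ for all $t\in\mathbb R$, where $a:\mathbb Z\to\mathbb C$ satisfies $\sum_k|a[k]||\lambda[j-2k]|<\infty$ for every $j\in\mathbb Z$ (as is the case if $a$ is bounded, or if $\lambda$ has finite support). 1. The scheme started from $c=a$ converges to $f$. (In particular, if $f$ is reconstructed from its samples $c[k]=f(k)$ by $f(t)=\sum_kc[k]\,\phi^+_{\lambda,\boldsymbol\alpha}(t-k)$, the scheme started from these samples converges to $f$.) 2. Suppose that the centered generator is interpolatory, i.e. $\phi_{\lambda,\boldsymbol\alpha}(0)=1$ and $\phi_{\lambda,\boldsymbol\alpha}(k)=0$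 for all integers $k\ne0$. Then the scheme started from the samples $c[k]=f(k)$ converges to the delayed function $f(\cdot-(n_0-1))$, and the scheme started from the samples $c[k]=f(k+n_0-1)$ converges to $f$. -/

import Mathlib

open MeasureTheory

namespace ExpSpline

noncomputable section

/-! ### Exponential B-splines and the generator -/

/-- The first-order causal exponential B-spline: `e^{at}` on `[0, 1)` and `0` elsewhere. -/
def firstOrderSpline (a : ℂ) : ℝ → ℂ :=
  (Set.Ico (0 : ℝ) 1).indicator fun t => Complex.exp (a * t)

open scoped Convolution in
/-- The causal exponential B-spline `β⁺_α` of the root vector `α = (α₁, …, α_n)`, `n ≥ 1`: the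
convolution of the first-order splines of its roots. (For the empty vector, which is never used,
the value is `0`.) Its Fourier transform is computed in `fourier_bspline`. -/
def bspline : (n : ℕ) → (Fin n → ℂ) → ℝ → ℂ
  | 0, _ => fun _ => 0
  | 1, α => firstOrderSpline (α 0)
  | n + 2, α =>
    firstOrderSpline (α 0) ⋆[ContinuousLinearMap.mul ℂ ℂ, volume] bspline (n + 1) (Fin.tail α)

/-- The factor `(1 - e^{a - iω}) / (iω - a)`, with its continuous value `1` at `iω = a`. -/
def splineFactor (a : ℂ) (ω : ℝ) : ℂ :=
  if Complex.I * ω = a then 1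
  else (1 - Complex.exp (a - Complex.I * ω)) / (Complex.I * ω - a)

/-- The centered exponential B-spline `β_α(t) = β⁺_α(t + n₀/2)`. -/
def centeredBspline {n₀ : ℕ} (α : Fin n₀ → ℂ) (t : ℝ) : ℂ :=
  bspline n₀ α (t + (n₀ : ℝ) / 2)

/-- The generator `φ_{λ,α}(t) = ∑_n λ[n] β_α(t - n/2)`. -/
def generator (lam : ℤ → ℂ) {n₀ : ℕ} (α : Fin n₀ → ℂ) (t : ℝ) : ℂ :=
  ∑' n : ℤ, lam n * centeredBspline α (t - (n : ℝ) / 2)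

/-- The causal generator `φ⁺_{λ,α}(t) = φ_{λ,α}(t - (n₀ - 1))`. -/
def causalGenerator (lam : ℤ → ℂ) {n₀ : ℕ} (α : Fin n₀ → ℂ) (t : ℝ) : ℂ :=
  generator lam α (t - ((n₀ : ℝ) - 1))

/-- The interpolation condition `φ(k) = δ[k]` for all integers `k`. -/
def Interpolatory (φ : ℝ → ℂ) : Prop :=
  ∀ k : ℤ, φ k = if k = 0 then 1 else 0

/-! ### Digital filters -/

/-- The digital filter `a` with discrete Fourier transform `∑_k a[k] e^{-iωk} = F(ω)`, i.e.
`a[k] = (1/2π) ∫_{-π}^{π} F(ω) e^{iωk} dω`. -/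
def digitalFilter (F : ℝ → ℂ) (k : ℤ) : ℂ :=
  1 / (2 * (Real.pi : ℂ)) *
    ∫ ω in (-Real.pi)..Real.pi, F ω * Complex.exp (Complex.I * ω * k)

/-- `H_{α,m}(e^{iω}) = m^{-(n₀-1)} ∏_j ∑_{k=0}^{m-1} e^{α_j k} e^{-ikω}`. -/
def refinementSymbol {n₀ : ℕ} (α : Fin n₀ → ℂ) (m : ℕ) (ω : ℝ) : ℂ :=
  1 / (m : ℂ) ^ (n₀ - 1) *
    ∏ j : Fin n₀, ∑ k ∈ Finset.range m,
      Complex.exp (α j * k) * Complex.exp (-(Complex.I * k * ω))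

/-- The refinement filter `h_{α,m}`. -/
def refinementFilter {n₀ : ℕ} (α : Fin n₀ → ℂ) (m : ℕ) : ℤ → ℂ :=
  digitalFilter (refinementSymbol α m)

/-- `G_{λ,α,m₀}(e^{iω}) = e^{-iωm₀(n₀/2-1)} (∑_n λ[n] e^{-iωnm₀/2}) H_{α,m₀}(e^{iω})`. -/
def prefilterSymbol (lam : ℤ → ℂ) {n₀ : ℕ} (α : Fin n₀ → ℂ) (m₀ : ℕ) (ω : ℝ) : ℂ :=
  Complex.exp (-(Complex.I * ω * m₀ * ((n₀ : ℂ) / 2 - 1))) *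
    (∑' n : ℤ, lam n * Complex.exp (-(Complex.I * ω * n * m₀ / 2))) *
    refinementSymbol α m₀ ω

/-- The pre-filter `g_{λ,α,m₀}`. -/
def prefilter (lam : ℤ → ℂ) {n₀ : ℕ} (α : Fin n₀ → ℂ) (m₀ : ℕ) : ℤ → ℂ :=
  digitalFilter (prefilterSymbol lam α m₀)

/-- Discrete convolution `(a * b)[k] = ∑_n a[k - n] b[n]`. -/
def discreteConv (a b : ℤ → ℂ) (k : ℤ) : ℂ :=
  ∑' n : ℤ, a (k - n) * b n

/-- Upsampling: `c_{↑m}[mn] = c[n]`, and `c_{↑m}[k] = 0` when `m` does not divide `k`. -/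
def upsample (m : ℕ) (c : ℤ → ℂ) (k : ℤ) : ℂ :=
  if (m : ℤ) ∣ k then c (k / m) else 0

/-- The refinement scheme `c₀, c₁, c₂, …` started from the sequence `c`. -/
def scheme (lam : ℤ → ℂ) {n₀ : ℕ} (α : Fin n₀ → ℂ) (m m₀ : ℕ) (c : ℤ → ℂ) : ℕ → ℤ → ℂ
  | 0 => discreteConv (prefilter lam (fun j => α j / m₀) m₀) (upsample m₀ c)
  | n + 1 =>
    discreteConv (refinementFilter (fun j => α j / (m₀ * (m : ℂ) ^ (n + 1))) m)
      (upsample m (scheme lam α m m₀ c n))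

/-! ### Convergence of Dirac combs -/

/-- The pairing of the Dirac comb `∑_k c[k] δ(s t - k)`, `s > 0`, with the test function `ψ`;
by the scaling rule for distributions, `δ(s · - k)` maps `ψ` to `s⁻¹ ψ(k / s)`. -/
def combPairing (s : ℝ) (c : ℤ → ℂ) (ψ : ℝ → ℂ) : ℂ :=
  ∑' k : ℤ, c k * ((s : ℂ)⁻¹ * ψ ((k : ℝ) / s))

open scoped ContDiff in
/-- The Dirac combs `∑_k c_n[k] δ(s_n t - k)` converge to the locally integrable function `f` in
the sense of distributions. (Against a compactly supported test function every comb is a finite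
sum.) -/
def CombsTendsto (s : ℕ → ℝ) (c : ℕ → ℤ → ℂ) (f : ℝ → ℂ) : Prop :=
  LocallyIntegrable f ∧
    ∀ ψ : ℝ → ℂ, ContDiff ℝ ∞ ψ → HasCompactSupport ψ →
      Filter.Tendsto (fun n => combPairing (s n) (c n) ψ) Filter.atTop (nhds (∫ t, f t * ψ t))

/-- The Dirac combs `∑_k c_n[k] δ(s_n t - k)` converge to `f` in the sense of tempered
distributions; all the pairings converge absolutely. -/
def CombsTendstoTempered (s : ℕ → ℝ) (c : ℕ → ℤ → ℂ) (f : ℝ → ℂ) : Prop :=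
  ∀ ψ : SchwartzMap ℝ ℂ,
    (∀ n, Summable fun k : ℤ => c n k * (((s n : ℝ) : ℂ)⁻¹ * ψ ((k : ℝ) / s n))) ∧
    Integrable (fun t => f t * ψ t) ∧
    Filter.Tendsto (fun n => combPairing (s n) (c n) ψ) Filter.atTop (nhds (∫ t, f t * ψ t))

/-- The coefficients `a` are admissible for `λ`: for every `j`, the series
`∑_k a[k] λ[j - 2k]` converges absolutely. This is what makes `∑_k a[k] φ⁺_{λ,α}(t - k)` an
absolutely convergent double series. It holds if `a` is bounded and `λ ∈ ℓ¹`, and for all `a` if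
`λ` has finite support. -/
def Admissible (lam a : ℤ → ℂ) : Prop :=
  ∀ j : ℤ, Summable fun k : ℤ => ‖a k‖ * ‖lam (j - 2 * k)‖

/-- The sums `∑_k |a[k]| |λ[j - 2k]|` grow at most polynomially in `j`. It holds if `a` is bounded
and `λ ∈ ℓ¹`, and if `a` grows at most polynomially and `λ` has finite support. -/
def SlowGrowth (lam a : ℤ → ℂ) : Prop :=
  ∃ (C : ℝ) (N : ℕ), ∀ j : ℤ, ∑' k : ℤ, ‖a k‖ * ‖lam (j - 2 * k)‖ ≤ C * (1 + |(j : ℝ)|) ^ N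

/-- The combs `∑_k c_n[k] δ(m₀ mⁿ t - k)` of the scheme started from `c` converge to `f`: in the
sense of distributions and, if `c` has slow growth, also of tempered distributions. -/
def SchemeConverges (lam : ℤ → ℂ) {n₀ : ℕ} (α : Fin n₀ → ℂ) (m m₀ : ℕ) (c : ℤ → ℂ)
    (f : ℝ → ℂ) : Prop :=
  CombsTendsto (fun n => (m₀ : ℝ) * (m : ℝ) ^ n) (scheme lam α m m₀ c) f ∧
    (SlowGrowth lam c →
      CombsTendstoTempered (fun n => (m₀ : ℝ) * (m : ℝ) ^ n) (scheme lam α m m₀ c) f)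

/-! ### The B-spline has the expected Fourier transform -/

theorem integrable_firstOrderSpline (a : ℂ) : Integrable (firstOrderSpline a) := by
  have h : IntegrableOn (fun t : ℝ => Complex.exp (a * t)) (Set.Icc (0 : ℝ) 1) :=
    Continuous.integrableOn_Icc (by fun_prop)
  exact (integrable_indicator_iff measurableSet_Ico).2 (h.mono_set Set.Ico_subset_Icc_self)

theorem integrable_bspline : ∀ (n : ℕ) (α : Fin n → ℂ), Integrable (bspline n α)
  | 0, _ => integrable_zero _ _ _
  | 1, α => integrable_firstOrderSpline (α 0)
  | n + 2, α =>
    (integrable_firstOrderSpline (α 0)).integrable_convolution _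
      (integrable_bspline (n + 1) (Fin.tail α))

theorem fourier_firstOrderSpline (a : ℂ) (ω : ℝ) :
    ∫ t : ℝ, firstOrderSpline a t * Complex.exp (-(Complex.I * ω * t)) = splineFactor a ω := by
  have h1 : (fun t : ℝ => firstOrderSpline a t * Complex.exp (-(Complex.I * ω * t))) =
      (Set.Ico (0 : ℝ) 1).indicator fun t : ℝ => Complex.exp ((a - Complex.I * ω) * t) := by
    funext t
    by_cases ht : t ∈ Set.Ico (0 : ℝ) 1
    · rw [firstOrderSpline, Set.indicator_of_mem ht, Set.indicator_of_mem ht, ← Complex.exp_add]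
      congr 1
      ring
    · rw [firstOrderSpline, Set.indicator_of_notMem ht, Set.indicator_of_notMem ht, zero_mul]
  rw [h1, integral_indicator measurableSet_Ico, integral_Ico_eq_integral_Ioo,
    ← integral_Ioc_eq_integral_Ioo, ← intervalIntegral.integral_of_le zero_le_one, splineFactor]
  split_ifs with h
  · simp [h]
  · have h2 : a - Complex.I * ω ≠ 0 := fun h3 => h (sub_eq_zero.1 h3).symm
    have h4 : Complex.I * ω - a ≠ 0 := fun h3 => h (sub_eq_zero.1 h3)
    rw [integral_exp_mul_complex h2, div_eq_div_iff h2 h4]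
    simp
    ring

open scoped FourierTransform in
/-- The Fourier transform of `β⁺_α` is `∏_j (1 - e^{α_j - iω}) / (iω - α_j)`. -/
theorem fourier_bspline : ∀ (n : ℕ) (α : Fin (n + 1) → ℂ) (ω : ℝ),
    ∫ t : ℝ, bspline (n + 1) α t * Complex.exp (-(Complex.I * ω * t)) =
      ∏ j : Fin (n + 1), splineFactor (α j) ω := by
  have key : ∀ (f : ℝ → ℂ) (ω : ℝ),
      ∫ t : ℝ, f t * Complex.exp (-(Complex.I * ω * t)) = 𝓕 f (ω / (2 * Real.pi)) := by
    intro f ω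
    rw [Real.fourier_real_eq_integral_exp_smul]
    refine integral_congr_ae (Filter.Eventually.of_forall fun t => ?_)
    simp only [smul_eq_mul]
    rw [mul_comm]
    congr 2
    have : (Real.pi : ℂ) ≠ 0 := by exact_mod_cast Real.pi_ne_zero
    push_cast
    field_simp
  intro n
  induction n with
  | zero =>
    intro α ω
    simpa [bspline] using fourier_firstOrderSpline (α 0) ω
  | succ n ih =>
    intro α ω
    rw [key, bspline, Real.fourier_mul_convolution_eq (integrable_firstOrderSpline _)
      (integrable_bspline _ _), ← key, ← key, fourier_firstOrderSpline, ih]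
    exact (Fin.prod_univ_succ fun j => splineFactor (α j) ω).symm

end

end ExpSpline

open MeasureTheory

/-!
# Convergence of the refinement scheme for exponential splines

The scheme has a closed form. The product symbol of the refinement filter `h_{α,M}` expands into
one term for each lattice point `i` of the box `{0, …, M - 1}^{n₀}`, with weight
`M^{-(n₀-1)} e^{∑ⱼ αⱼ iⱼ}` and position `∑ⱼ iⱼ` (`boxFilter`). A refinement by `m` following one by
`M` is a refinement by `Mm`, since every digit below `Mm` is uniquely `mI + i`
(`boxFilter_upsample_boxFilter`). With `m₀ = 2q`, the pre-filter turns `c` into the refinement by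
`m₀` of the sequence `b[l] = ∑_k c[k] λ[l - (n₀ - 2) - 2k]` placed on the lattice `qℤ`. Hence the
`p`-th sequence of the scheme is the refinement by `s = m₀ mᵖ` of `b` placed on `(s/2)ℤ`
(`scheme_eq_boxFilter`).

Pairing its comb with a test function `ψ` therefore gives `∑_l b[l] A_s(l/2)`, where `A_s(x)` is
the Riemann sum with mesh `1/s` of `v ↦ e^{α·v} ψ(x + ∑ⱼ vⱼ)` over the unit cube
(`hasSum_comb_boxFilter`). As `s → ∞`, the Riemann sums tend to `∫ β⁺_α(t) ψ(x + t) dt`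
(`tendsto_boxAverage`, by induction over the factors of the convolution). Moreover
`|A_s(l/2)| ≤ e^{∑|αⱼ|} sup_{0 ≤ y ≤ n₀} |ψ(l/2 + y)|`, so dominated convergence for series applies
as soon as these suprema are summable against `|b[l]|`: trivially for compactly supported `ψ`, and
by rapid decay for Schwartz functions when `b` grows polynomially. The limit is the pairing of `ψ`
with `∑_l b[l] β⁺_α(t - l/2)`, which is a rearrangement of `∑_k c[k] φ⁺_{λ,α}(t - k)`
(`tsum_causalGenerator`).

For an interpolatory generator the samples `f(k)` are the coefficients `a[k - (n₀ - 1)]`, which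
reduces the second part to the first.
-/

namespace ExpSpline

noncomputable section

/-! ### Filters with absolutely summable symbols -/

/-- The characters `ω ↦ e^{iωn}`, `n ∈ ℤ`, are orthogonal on `[-π, π]`. -/
theorem integral_exp_I_mul_int (n : ℤ) :
    ∫ ω in (-Real.pi)..Real.pi, Complex.exp (Complex.I * ω * n) =
      if n = 0 then 2 * (Real.pi : ℂ) else 0 := by
  split_ifs with h
  · simp [h]
    ring
  · have h1 : Complex.I * (n : ℂ) ≠ 0 := mul_ne_zero Complex.I_ne_zero (by exact_mod_cast h)
    have h2 : ∀ ω : ℝ, Complex.exp (Complex.I * ω * n) = Complex.exp (Complex.I * n * ω) :=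
      fun ω => by congr 1; ring
    simp only [h2]
    rw [integral_exp_mul_complex h1, div_eq_zero_iff, sub_eq_zero]
    left
    rw [Complex.exp_eq_exp_iff_exists_int]
    exact ⟨n, by push_cast; ring⟩

/-- If the symbol is the absolutely convergent sum `∑ᵢ wᵢ e^{-iωκᵢ}`, then the filter puts the
weights `wᵢ` at the positions `κᵢ`. -/
theorem digitalFilter_tsum {ι : Type*} [Countable ι] (w : ι → ℂ) (κ : ι → ℤ)
    (hw : Summable fun i => ‖w i‖) (k : ℤ) :
    digitalFilter (fun ω => ∑' i, w i * Complex.exp (-(Complex.I * ω * κ i))) k =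
      ∑' i, if κ i = k then w i else 0 := by
  have hnorm : ∀ (i : ι) (ω : ℝ), ‖w i * Complex.exp (-(Complex.I * ω * κ i))‖ = ‖w i‖ := by
    intro i ω
    have h : -(Complex.I * ω * κ i) = ((-(ω * κ i) : ℝ) : ℂ) * Complex.I := by push_cast; ring
    rw [norm_mul, h, Complex.norm_exp_ofReal_mul_I, mul_one]
  have hexp : ∀ ω : ℝ, ‖Complex.exp (Complex.I * ω * k)‖ = 1 := by
    intro ω
    have h : Complex.I * ω * k = ((ω * k : ℝ) : ℂ) * Complex.I := by push_cast; ring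
    rw [h, Complex.norm_exp_ofReal_mul_I]
  have hsum : HasSum
      (fun i => ∫ ω in (-Real.pi)..Real.pi,
        w i * Complex.exp (-(Complex.I * ω * κ i)) * Complex.exp (Complex.I * ω * k))
      (∫ ω in (-Real.pi)..Real.pi,
        (∑' i, w i * Complex.exp (-(Complex.I * ω * κ i))) * Complex.exp (Complex.I * ω * k)) := by
    refine intervalIntegral.hasSum_integral_of_dominated_convergence (fun i _ => ‖w i‖)
      (fun i => ?_) (fun i => ?_) ?_ ?_ ?_
    · exact Continuous.aestronglyMeasurable (by fun_prop)
    · exact Filter.Eventually.of_forall fun ω _ => by rw [norm_mul, hnorm, hexp, mul_one]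
    · exact Filter.Eventually.of_forall fun ω _ => hw
    · exact intervalIntegrable_const
    · refine Filter.Eventually.of_forall fun ω _ => HasSum.mul_right _ ?_
      exact (Summable.of_norm (by simpa only [hnorm] using hw)).hasSum
  rw [digitalFilter, ← hsum.tsum_eq, ← tsum_mul_left]
  refine tsum_congr fun i => ?_
  have h1 : ∀ ω : ℝ, w i * Complex.exp (-(Complex.I * ω * κ i)) * Complex.exp (Complex.I * ω * k) =
      w i * Complex.exp (Complex.I * ω * ((k - κ i : ℤ) : ℂ)) := by
    intro ω
    rw [mul_assoc, ← Complex.exp_add]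
    congr 2
    push_cast
    ring
  simp only [h1]
  rw [intervalIntegral.integral_const_mul, integral_exp_I_mul_int]
  have hpi : (Real.pi : ℂ) ≠ 0 := by exact_mod_cast Real.pi_ne_zero
  by_cases h : κ i = k
  · simp [h]
    field_simp
  · rw [if_neg (by omega), if_neg h, mul_zero, mul_zero]

/-! ### The refinement filter as a sum over a box -/

/-- The weight `M^{-(n-1)} e^{∑ⱼ αⱼ iⱼ}` of the lattice point `i` of the box `{0, …, M - 1}ⁿ`. -/
def boxWeight {n : ℕ} (M : ℕ) (α : Fin n → ℂ) (i : Fin n → Fin M) : ℂ :=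
  1 / (M : ℂ) ^ (n - 1) * Complex.exp (∑ j, α j * ((i j : ℕ) : ℂ))

/-- The coordinate sum `∑ⱼ iⱼ` of a lattice point of the box `{0, …, M - 1}ⁿ`. -/
def boxSum {n M : ℕ} (i : Fin n → Fin M) : ℤ :=
  ∑ j, ((i j : ℕ) : ℤ)

/-- Convolution of `d` with the refinement filter `h_{α,M}`, whose expanded product symbol has one
term for each lattice point of the box `{0, …, M - 1}ⁿ`. -/
def boxFilter {n : ℕ} (M : ℕ) (α : Fin n → ℂ) (d : ℤ → ℂ) (k : ℤ) : ℂ :=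
  ∑ i : Fin n → Fin M, boxWeight M α i * d (k - boxSum i)

theorem refinementSymbol_eq_sum {n : ℕ} (α : Fin n → ℂ) (M : ℕ) (ω : ℝ) :
    refinementSymbol α M ω =
      ∑ i : Fin n → Fin M, boxWeight M α i * Complex.exp (-(Complex.I * ω * boxSum i)) := by
  rw [refinementSymbol]
  simp only [Finset.sum_range]
  rw [Finset.prod_univ_sum, Finset.mul_sum, Fintype.piFinset_univ]
  refine Finset.sum_congr rfl fun i _ => ?_
  rw [boxWeight, mul_assoc, ← Complex.exp_add]
  simp only [← Complex.exp_add]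
  rw [← Complex.exp_sum]
  congr 2
  rw [Finset.sum_add_distrib, boxSum]
  congr 1
  push_cast
  rw [Finset.mul_sum, ← Finset.sum_neg_distrib]
  exact Finset.sum_congr rfl fun j _ => by ring

theorem refinementFilter_apply {n : ℕ} (α : Fin n → ℂ) (M : ℕ) (k : ℤ) :
    refinementFilter α M k =
      ∑ i : Fin n → Fin M, if boxSum i = k then boxWeight M α i else 0 := by
  have h : refinementSymbol α M = fun ω : ℝ => ∑' i : Fin n → Fin M,
      boxWeight M α i * Complex.exp (-(Complex.I * ω * boxSum i)) := by
    funext ω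
    rw [refinementSymbol_eq_sum, tsum_fintype]
  rw [refinementFilter, h, digitalFilter_tsum _ _ (Summable.of_finite), tsum_fintype]

theorem discreteConv_refinementFilter {n : ℕ} (α : Fin n → ℂ) (M : ℕ) (d : ℤ → ℂ) :
    discreteConv (refinementFilter α M) d = boxFilter M α d := by
  funext k
  rw [discreteConv, boxFilter]
  simp only [refinementFilter_apply, Finset.sum_mul]
  refine (hasSum_sum fun i _ => ?_).tsum_eq
  have h := hasSum_single (f := fun l : ℤ => (if boxSum i = k - l then boxWeight M α i else 0) * d l)
    (k - boxSum i) (fun l hl => by rw [if_neg (by omega), zero_mul])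
  simpa using h

/-! ### Upsampling and the closed form of the scheme -/

theorem upsample_eq_tsum {m : ℕ} (hm : 0 < m) (c : ℤ → ℂ) (k : ℤ) :
    upsample m c k = ∑' n : ℤ, if (m : ℤ) * n = k then c n else 0 := by
  have hm' : (m : ℤ) ≠ 0 := by exact_mod_cast hm.ne'
  rw [upsample]
  split_ifs with h
  · obtain ⟨l, rfl⟩ := h
    rw [Int.mul_ediv_cancel_left _ hm', tsum_eq_single l, if_pos rfl]
    intro n hn
    rw [if_neg fun h => hn (mul_left_cancel₀ hm' h)]
  · have h1 : ∀ n : ℤ, (if (m : ℤ) * n = k then c n else 0) = 0 :=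
      fun n => if_neg fun h2 => h ⟨n, h2.symm⟩
    simp only [h1, tsum_zero]

theorem upsample_mul_left {m : ℕ} (hm : 0 < m) (c : ℤ → ℂ) (l : ℤ) :
    upsample m c (m * l) = c l := by
  rw [upsample, if_pos (dvd_mul_right _ _), Int.mul_ediv_cancel_left _ (by exact_mod_cast hm.ne')]

theorem support_upsample_subset (m : ℕ) (c : ℤ → ℂ) :
    Function.support (upsample m c) ⊆ Set.range fun l : ℤ => (m : ℤ) * l := by
  intro k hk
  rw [Function.mem_support, upsample] at hk
  split_ifs at hk with h
  · obtain ⟨l, rfl⟩ := h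
    exact ⟨l, rfl⟩
  · exact absurd rfl hk

theorem injective_natCast_mul {m : ℕ} (hm : 0 < m) :
    Function.Injective fun l : ℤ => (m : ℤ) * l :=
  mul_right_injective₀ (by exact_mod_cast hm.ne')

theorem upsample_upsample {m : ℕ} (hm : 0 < m) (u : ℕ) (c : ℤ → ℂ) :
    upsample m (upsample u c) = upsample (u * m) c := by
  have hm' : (m : ℤ) ≠ 0 := by exact_mod_cast hm.ne'
  funext k
  by_cases h : (m : ℤ) ∣ k
  · obtain ⟨l, rfl⟩ := h
    rw [upsample_mul_left hm, upsample, upsample]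
    push_cast
    simp only [mul_comm (u : ℤ), mul_dvd_mul_iff_left hm',
      Int.mul_ediv_mul_of_pos _ _ (show (0 : ℤ) < m by omega)]
  · rw [upsample, if_neg h, upsample, if_neg fun h1 => h ?_]
    push_cast at h1
    exact (dvd_mul_left _ _).trans h1

/-- Two refinement steps amount to one: the boxes `{0, …, M - 1}ⁿ` and `{0, …, m - 1}ⁿ` combine
into `{0, …, Mm - 1}ⁿ` by writing a digit of the latter as `mI + i`. -/
theorem boxFilter_upsample_boxFilter {n m : ℕ} (hm : 0 < m) (M : ℕ) (α : Fin n → ℂ) (d : ℤ → ℂ) :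
    boxFilter m α (upsample m (boxFilter M (fun j => m * α j) d)) =
      boxFilter (M * m) α (upsample m d) := by
  funext k
  have h1 : ∀ y : ℤ, upsample m (boxFilter M (fun j => m * α j) d) y =
      ∑ I : Fin n → Fin M, boxWeight M (fun j => m * α j) I * upsample m d (y - m * boxSum I) := by
    intro y
    by_cases h : (m : ℤ) ∣ y
    · obtain ⟨l, rfl⟩ := h
      simp only [← mul_sub, upsample_mul_left hm]
      rfl
    · rw [upsample, if_neg h, eq_comm]
      refine Finset.sum_eq_zero fun I _ => ?_
      rw [upsample, if_neg fun h2 => h ((Int.dvd_iff_dvd_of_dvd_sub ?_).2 h2), mul_zero]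
      exact ⟨boxSum I, by ring⟩
  let e : (Fin n → Fin m) × (Fin n → Fin M) ≃ (Fin n → Fin (M * m)) :=
    (Equiv.prodComm _ _).trans ((Equiv.arrowProdEquivProdArrow (Fin n) _ _).symm.trans
      (Equiv.arrowCongr (Equiv.refl (Fin n)) finProdFinEquiv))
  have he : ∀ p j, ((e p j : Fin (M * m)) : ℕ) = (p.1 j : ℕ) + m * (p.2 j : ℕ) := fun p j => rfl
  rw [boxFilter, boxFilter, ← e.sum_comp, Fintype.sum_prod_type]
  refine Finset.sum_congr rfl fun i _ => ?_
  rw [h1, Finset.mul_sum]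
  refine Finset.sum_congr rfl fun I _ => ?_
  rw [← mul_assoc]
  congr 1
  · simp only [boxWeight, he]
    rw [mul_mul_mul_comm, ← Complex.exp_add, ← Finset.sum_add_distrib]
    congr 1
    · push_cast
      rw [mul_pow]
      ring
    · congr 1
      refine Finset.sum_congr rfl fun j _ => ?_
      push_cast
      ring
  · congr 1
    simp only [boxSum, he]
    push_cast
    rw [Finset.sum_add_distrib, ← Finset.mul_sum]
    ring

/-- The coefficients `∑_k a[k] λ[j - 2k]` of the expansion of a spline in the half-integer shifts
of the B-spline. -/
def halfShiftCoeff (lam a : ℤ → ℂ) (j : ℤ) : ℂ :=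
  ∑' k : ℤ, a k * lam (j - 2 * k)

theorem prefilter_apply (lam : ℤ → ℂ) (hlam : Summable fun n : ℤ => ‖lam n‖) {n : ℕ}
    (α : Fin n → ℂ) {q : ℕ} (hq : 0 < q) (k : ℤ) :
    prefilter lam α (2 * q) k =
      boxFilter (2 * q) α (fun y => upsample q lam (y - q * ((n : ℤ) - 2))) k := by
  have hsymb : prefilterSymbol lam α (2 * q) = fun ω : ℝ =>
      ∑' p : (Fin n → Fin (2 * q)) × ℤ, (boxWeight (2 * q) α p.1 * lam p.2) *
        Complex.exp (-(Complex.I * ω * ((boxSum p.1 + q * ((n : ℤ) - 2) + q * p.2 : ℤ) : ℂ))) := by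
    funext ω
    have hs : Summable fun l : ℤ =>
        lam l * Complex.exp (-(Complex.I * ω * l * ((2 * q : ℕ) : ℂ) / 2)) := by
      refine Summable.of_norm (hlam.congr fun l => ?_)
      have h : -(Complex.I * ω * l * ((2 * q : ℕ) : ℂ) / 2) =
          ((-(ω * l * q) : ℝ) : ℂ) * Complex.I := by push_cast; ring
      rw [norm_mul, h, Complex.norm_exp_ofReal_mul_I, mul_one]
    have hf : Summable fun i : Fin n → Fin (2 * q) =>
        boxWeight (2 * q) α i * Complex.exp (-(Complex.I * ω * boxSum i)) := Summable.of_finite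
    rw [prefilterSymbol, refinementSymbol_eq_sum, mul_assoc,
      mul_comm (∑' l : ℤ, lam l * _), ← tsum_fintype (L := SummationFilter.unconditional _),
      tsum_mul_tsum_of_summable_norm hf.norm hs.norm, ← tsum_mul_left]
    refine tsum_congr fun p => ?_
    have h1 : Complex.exp (-(Complex.I * ω * ((boxSum p.1 + q * ((n : ℤ) - 2) + q * p.2 : ℤ) : ℂ)))
        = Complex.exp (-(Complex.I * ω * ((2 * q : ℕ) : ℂ) * ((n : ℂ) / 2 - 1))) *
          (Complex.exp (-(Complex.I * ω * boxSum p.1)) *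
            Complex.exp (-(Complex.I * ω * p.2 * ((2 * q : ℕ) : ℂ) / 2))) := by
      rw [← Complex.exp_add, ← Complex.exp_add]
      congr 1
      push_cast
      ring
    rw [h1]
    ring
  have hsum : Summable fun p : (Fin n → Fin (2 * q)) × ℤ =>
      ‖boxWeight (2 * q) α p.1 * lam p.2‖ := by
    have hf : Summable fun i : Fin n → Fin (2 * q) => ‖boxWeight (2 * q) α i‖ := Summable.of_finite
    simpa only [norm_mul] using hf.mul_of_nonneg hlam (fun _ => norm_nonneg _) fun _ => norm_nonneg _
  rw [prefilter, hsymb, digitalFilter_tsum _ _ hsum, Summable.tsum_prod, tsum_fintype, boxFilter]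
  · refine Finset.sum_congr rfl fun i _ => ?_
    rw [upsample_eq_tsum hq, ← tsum_mul_left]
    refine tsum_congr fun l => ?_
    dsimp only
    rw [mul_ite, mul_zero]
    exact if_congr (by constructor <;> intro h <;> linarith) rfl rfl
  · refine Summable.of_norm_bounded hsum fun p => ?_
    split_ifs
    · exact le_rfl
    · rw [norm_zero]
      exact norm_nonneg _

theorem scheme_zero_eq (lam : ℤ → ℂ) (hlam : Summable fun n : ℤ => ‖lam n‖) {n : ℕ}
    (α : Fin n → ℂ) (m : ℕ) {q : ℕ} (hq : 0 < q) (a : ℤ → ℂ) (ha : Admissible lam a) :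
    scheme lam α m (2 * q) a 0 = boxFilter (2 * q) (fun j => α j / (2 * q : ℕ))
      (upsample q fun l => halfShiftCoeff lam a (l - ((n : ℤ) - 2))) := by
  have hq' : (q : ℤ) ≠ 0 := by exact_mod_cast hq.ne'
  -- On the lattice `qℤ` the sum is a half-shift coefficient; off it, every term vanishes.
  have key : ∀ y : ℤ, HasSum
      (fun l : ℤ => upsample q lam (y - ((2 * q : ℕ) : ℤ) * l - q * ((n : ℤ) - 2)) * a l)
      (upsample q (fun l => halfShiftCoeff lam a (l - ((n : ℤ) - 2))) y) := by
    intro y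
    by_cases h : (q : ℤ) ∣ y
    · obtain ⟨z, rfl⟩ := h
      rw [upsample_mul_left hq, halfShiftCoeff]
      have h1 : ∀ l : ℤ, (q : ℤ) * z - ((2 * q : ℕ) : ℤ) * l - q * ((n : ℤ) - 2) =
          q * (z - ((n : ℤ) - 2) - 2 * l) := fun l => by push_cast; ring
      simp only [h1, upsample_mul_left hq]
      simp only [mul_comm (lam _)]
      refine (Summable.of_norm ?_).hasSum
      simpa only [norm_mul] using ha (z - ((n : ℤ) - 2))
    · have h2 : ∀ l : ℤ, upsample q lam (y - ((2 * q : ℕ) : ℤ) * l - q * ((n : ℤ) - 2)) * a l = 0 := by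
        intro l
        rw [upsample, if_neg fun h2 => h ((Int.dvd_iff_dvd_of_dvd_sub ?_).2 h2), zero_mul]
        exact ⟨2 * l + ((n : ℤ) - 2), by push_cast; ring⟩
      simp only [h2]
      rw [upsample, if_neg h]
      exact hasSum_zero
  funext k
  have h2q : 0 < 2 * q := by omega
  rw [scheme, discreteConv, ← (injective_natCast_mul h2q).tsum_eq]
  · simp only [upsample_mul_left h2q, prefilter_apply lam hlam _ hq, boxFilter, Finset.sum_mul]
    refine (hasSum_sum fun i _ => ?_).tsum_eq
    refine ((key (k - boxSum i)).mul_left (boxWeight (2 * q) (fun j => α j / (2 * q : ℕ)) i)).congr_fun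
      fun l => ?_
    rw [mul_assoc]
    congr 4
    ring
  · intro l hl
    exact support_upsample_subset (2 * q) a (right_ne_zero_of_mul (Function.mem_support.1 hl))

/-- After `p` steps the scheme has applied one refinement by the factor `m₀mᵖ = 2qmᵖ` to the
half-shift coefficients. -/
theorem scheme_eq_boxFilter (lam : ℤ → ℂ) (hlam : Summable fun n : ℤ => ‖lam n‖) {n : ℕ}
    (α : Fin n → ℂ) {m : ℕ} (hm : 0 < m) {q : ℕ} (hq : 0 < q) (a : ℤ → ℂ) (ha : Admissible lam a)
    (p : ℕ) :
    scheme lam α m (2 * q) a p =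
      boxFilter (2 * (q * m ^ p)) (fun j => α j / (2 * (q * m ^ p) : ℕ))
        (upsample (q * m ^ p) fun l => halfShiftCoeff lam a (l - ((n : ℤ) - 2))) := by
  induction p with
  | zero => simpa using scheme_zero_eq lam hlam α m hq a ha
  | succ p ih =>
    have hm' : (m : ℂ) ≠ 0 := by exact_mod_cast hm.ne'
    have h1 : (fun j => α j / ((2 * (q * m ^ p) : ℕ) : ℂ)) =
        fun j => (m : ℂ) * (α j / (((2 * q : ℕ) : ℂ) * (m : ℂ) ^ (p + 1))) := by
      funext j
      push_cast
      field_simp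
      ring
    rw [scheme, ih, discreteConv_refinementFilter, h1, boxFilter_upsample_boxFilter hm,
      upsample_upsample hm]
    have h2 : 2 * (q * m ^ p) * m = 2 * (q * m ^ (p + 1)) := by ring
    have h3 : q * m ^ p * m = q * m ^ (p + 1) := by ring
    rw [h2, h3]
    congr 1
    funext j
    push_cast
    rw [mul_assoc]

/-! ### Riemann sums for the B-spline -/

theorem intervalIntegrable_and_integral_comp_floor (G : ℕ → ℂ) (k : ℕ) :
    IntervalIntegrable (fun u : ℝ => G ⌊u⌋₊) volume (k : ℝ) ((k + 1 : ℕ) : ℝ) ∧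
      ∫ u in (k : ℝ)..((k + 1 : ℕ) : ℝ), G ⌊u⌋₊ = G k := by
  have hle : (k : ℝ) ≤ ((k + 1 : ℕ) : ℝ) := by push_cast; linarith
  have h : Set.EqOn (fun _ : ℝ => G k) (fun u : ℝ => G ⌊u⌋₊)
      (Set.Ioo (k : ℝ) ((k + 1 : ℕ) : ℝ)) := by
    intro u hu
    have h1 : ⌊u⌋₊ = k :=
      (Nat.floor_eq_iff (k.cast_nonneg.trans hu.1.le)).2 ⟨hu.1.le, by simpa using hu.2⟩
    simp only [h1]
  constructor
  · rw [intervalIntegrable_iff_integrableOn_Ioo_of_le hle]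
    exact IntegrableOn.congr_fun (integrableOn_const (by simp)) h measurableSet_Ioo
  · rw [intervalIntegral.integral_of_le hle, integral_Ioc_eq_integral_Ioo,
      ← setIntegral_congr_fun measurableSet_Ioo h]
    simp

/-- A Riemann sum as the integral of a step function. -/
theorem integral_comp_floor_mul {M : ℕ} (hM : 0 < M) (G : ℕ → ℂ) :
    ∫ t in (0 : ℝ)..1, G ⌊(M : ℝ) * t⌋₊ = 1 / (M : ℂ) * ∑ k : Fin M, G k := by
  have hM' : (M : ℝ) ≠ 0 := by exact_mod_cast hM.ne'
  rw [intervalIntegral.integral_comp_mul_left (fun u => G ⌊u⌋₊) hM', mul_zero, mul_one]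
  have h := intervalIntegral.sum_integral_adjacent_intervals (μ := volume)
    (f := fun u : ℝ => G ⌊u⌋₊) (a := fun k : ℕ => (k : ℝ)) (n := M)
    fun k _ => (intervalIntegrable_and_integral_comp_floor G k).1
  rw [Nat.cast_zero] at h
  rw [← h, Finset.sum_congr rfl fun k _ => (intervalIntegrable_and_integral_comp_floor G k).2, Finset.sum_range,
    Complex.real_smul]
  simp

theorem integral_firstOrderSpline_mul (a : ℂ) (F : ℝ → ℂ) :
    ∫ t, firstOrderSpline a t * F t = ∫ t in (0 : ℝ)..1, Complex.exp (a * t) * F t := by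
  have h : (fun t => firstOrderSpline a t * F t) =
      (Set.Ico (0 : ℝ) 1).indicator fun t => Complex.exp (a * t) * F t := by
    funext t
    by_cases ht : t ∈ Set.Ico (0 : ℝ) 1
    · rw [firstOrderSpline, Set.indicator_of_mem ht, Set.indicator_of_mem ht]
    · rw [firstOrderSpline, Set.indicator_of_notMem ht, Set.indicator_of_notMem ht, zero_mul]
  rw [h, integral_indicator measurableSet_Ico, integral_Ico_eq_integral_Ioo,
    ← integral_Ioc_eq_integral_Ioo, ← intervalIntegral.integral_of_le zero_le_one]

theorem norm_exp_mul_ofReal_le (a : ℂ) {t : ℝ} (h0 : 0 ≤ t) (h1 : t ≤ 1) :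
    ‖Complex.exp (a * t)‖ ≤ Real.exp ‖a‖ := by
  refine (Complex.norm_exp_le_exp_norm _).trans (Real.exp_le_exp.2 ?_)
  rw [norm_mul, Complex.norm_real, Real.norm_of_nonneg h0]
  exact mul_le_of_le_one_right (norm_nonneg _) h1

/-- Riemann sums converge when the integrands converge continuously, i.e. along all convergent
sequences of arguments. Unlike pointwise convergence, this hypothesis is reproduced by the
conclusion, which allows an iteration over the factors of the B-spline. -/
theorem tendsto_riemannSum (a : ℂ) {s : ℕ → ℕ} (hs : Filter.Tendsto s Filter.atTop Filter.atTop)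
    (F : ℕ → ℝ → ℂ) (F' : ℝ → ℂ) (C : ℝ) (hC : ∀ n x, ‖F n x‖ ≤ C)
    (hF : ∀ (y : ℕ → ℝ) (x : ℝ), Filter.Tendsto y Filter.atTop (nhds x) →
      Filter.Tendsto (fun n => F n (y n)) Filter.atTop (nhds (F' x)))
    (y : ℕ → ℝ) (x : ℝ) (hy : Filter.Tendsto y Filter.atTop (nhds x)) :
    Filter.Tendsto
      (fun n => 1 / (s n : ℂ) * ∑ k : Fin (s n),
        Complex.exp (a * (((k : ℕ) / (s n : ℝ) : ℝ) : ℂ)) * F n (y n + (k : ℕ) / (s n : ℝ)))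
      Filter.atTop (nhds (∫ t, firstOrderSpline a t * F' (x + t))) := by
  have hsR : Filter.Tendsto (fun n => (s n : ℝ)) Filter.atTop Filter.atTop :=
    tendsto_natCast_atTop_atTop.comp hs
  let G : ℕ → ℕ → ℂ := fun n k =>
    Complex.exp (a * (((k : ℕ) / (s n : ℝ) : ℝ) : ℂ)) * F n (y n + (k : ℕ) / (s n : ℝ))
  rw [integral_firstOrderSpline_mul]
  have hlim : Filter.Tendsto (fun n => ∫ t in (0 : ℝ)..1, G n ⌊(s n : ℝ) * t⌋₊) Filter.atTop
      (nhds (∫ t in (0 : ℝ)..1, Complex.exp (a * t) * F' (x + t))) := by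
    refine intervalIntegral.tendsto_integral_filter_of_dominated_convergence
      (fun _ => Real.exp ‖a‖ * C) ?_ ?_ intervalIntegrable_const ?_
    · refine Filter.Eventually.of_forall fun n => Measurable.aestronglyMeasurable ?_
      exact (measurable_from_top (f := G n)).comp
        (Nat.measurable_floor.comp (measurable_const.mul measurable_id))
    · refine Filter.Eventually.of_forall fun n => Filter.Eventually.of_forall fun t ht => ?_
      rw [Set.uIoc_of_le zero_le_one] at ht
      have h0 : (0 : ℝ) ≤ s n * t := mul_nonneg (Nat.cast_nonneg _) ht.1.le
      rw [norm_mul]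
      refine mul_le_mul (norm_exp_mul_ofReal_le a (by positivity) ?_) (hC _ _) (norm_nonneg _)
        (Real.exp_pos _).le
      refine div_le_one_of_le₀ ((Nat.floor_le h0).trans ?_) (Nat.cast_nonneg _)
      exact mul_le_of_le_one_right (Nat.cast_nonneg _) ht.2
    · refine Filter.Eventually.of_forall fun t ht => ?_
      rw [Set.uIoc_of_le zero_le_one] at ht
      have ht' : Filter.Tendsto (fun n => ((⌊(s n : ℝ) * t⌋₊ : ℕ) : ℝ) / (s n : ℝ)) Filter.atTop
          (nhds t) := by
        simpa only [mul_comm t, Function.comp_def] using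
          (tendsto_nat_floor_mul_div_atTop ht.1.le).comp hsR
      refine Filter.Tendsto.mul ?_ (hF _ _ (hy.add ht'))
      exact ((Complex.continuous_exp.tendsto _).comp
        (((Complex.continuous_ofReal.tendsto _).comp ht').const_mul a))
  refine hlim.congr' ?_
  filter_upwards [hs.eventually_gt_atTop 0] with n hn
  exact integral_comp_floor_mul hn (G n)

/-- The Riemann sum `M⁻ⁿ ∑ᵢ e^{∑ⱼ αⱼ iⱼ / M} ψ(x + ∑ⱼ iⱼ / M)` of
`v ↦ e^{∑ⱼ αⱼ vⱼ} ψ(x + ∑ⱼ vⱼ)` over the unit cube. -/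
def boxAverage {n : ℕ} (M : ℕ) (α : Fin n → ℂ) (ψ : ℝ → ℂ) (x : ℝ) : ℂ :=
  1 / (M : ℂ) ^ n * ∑ i : Fin n → Fin M,
    Complex.exp (∑ j, α j * (((i j : ℕ) / (M : ℝ) : ℝ) : ℂ)) * ψ (x + (boxSum i : ℝ) / M)

theorem boxAverage_zero {M : ℕ} (α : Fin 0 → ℂ) (ψ : ℝ → ℂ) (x : ℝ) :
    boxAverage M α ψ x = ψ x := by
  simp [boxAverage, boxSum]

theorem boxAverage_succ {n M : ℕ} (α : Fin (n + 1) → ℂ) (ψ : ℝ → ℂ) (x : ℝ) :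
    boxAverage M α ψ x = 1 / (M : ℂ) * ∑ k : Fin M,
      Complex.exp (α 0 * (((k : ℕ) / (M : ℝ) : ℝ) : ℂ)) *
        boxAverage M (Fin.tail α) ψ (x + (k : ℕ) / (M : ℝ)) := by
  rw [boxAverage, ← (Fin.consEquiv fun _ => Fin M).sum_comp, Fintype.sum_prod_type, pow_succ',
    ← div_div, div_eq_mul_one_div (1 / (M : ℂ)), mul_assoc, Finset.mul_sum]
  congr 1
  refine Finset.sum_congr rfl fun k _ => ?_
  rw [boxAverage, mul_left_comm]
  congr 1
  rw [Finset.mul_sum]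
  refine Finset.sum_congr rfl fun i _ => ?_
  simp only [Fin.consEquiv, Equiv.coe_fn_mk, Fin.sum_univ_succ, Fin.cons_zero, Fin.cons_succ,
    boxSum, Fin.tail]
  rw [Complex.exp_add, mul_assoc]
  congr 3
  push_cast
  ring

theorem norm_boxAverage_le {n : ℕ} (M : ℕ) (α : Fin n → ℂ) (ψ : ℝ → ℂ) (x D : ℝ)
    (hD : ∀ y ∈ Set.Icc (0 : ℝ) n, ‖ψ (x + y)‖ ≤ D) :
    ‖boxAverage M α ψ x‖ ≤ Real.exp (∑ j, ‖α j‖) * D := by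
  have hD0 : 0 ≤ D := (norm_nonneg _).trans (hD 0 ⟨le_rfl, Nat.cast_nonneg _⟩)
  have hterm : ∀ i : Fin n → Fin M,
      ‖Complex.exp (∑ j, α j * (((i j : ℕ) / (M : ℝ) : ℝ) : ℂ)) * ψ (x + (boxSum i : ℝ) / M)‖ ≤
        Real.exp (∑ j, ‖α j‖) * D := by
    intro i
    have hle : ∀ j, ((i j : ℕ) / (M : ℝ) : ℝ) ≤ 1 := fun j =>
      div_le_one_of_le₀ (by exact_mod_cast (i j).2.le) (Nat.cast_nonneg _)
    rw [norm_mul]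
    refine mul_le_mul ?_ (hD _ ⟨?_, ?_⟩) (norm_nonneg _) (Real.exp_pos _).le
    · rw [Complex.exp_sum, norm_prod, Real.exp_sum]
      exact Finset.prod_le_prod (fun _ _ => norm_nonneg _) fun j _ =>
        norm_exp_mul_ofReal_le _ (by positivity) (hle j)
    · rw [boxSum]
      positivity
    · rw [boxSum]
      push_cast
      rw [Finset.sum_div]
      refine (Finset.sum_le_sum fun j _ => hle j).trans ?_
      simp
  rw [boxAverage, norm_mul]
  have hsum := norm_sum_le_of_le Finset.univ fun i _ => hterm i
  rw [Finset.sum_const, Finset.card_univ, Fintype.card_pi, Finset.prod_const, Finset.card_univ,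
    Fintype.card_fin, Fintype.card_fin, nsmul_eq_mul] at hsum
  refine (mul_le_mul_of_nonneg_left hsum (norm_nonneg _)).trans ?_
  rw [← mul_assoc]
  refine mul_le_of_le_one_left (by positivity) ?_
  rw [norm_div, norm_one, norm_pow, Complex.norm_natCast, Nat.cast_pow]
  rw [one_div]
  exact inv_mul_le_one

/-- Fubini's theorem for the convolution that adds a root to the B-spline. -/
theorem integral_bspline_succ_mul {n : ℕ} (α : Fin (n + 2) → ℂ) {ψ : ℝ → ℂ} (hψ : Continuous ψ)
    {C : ℝ} (hC : ∀ x, ‖ψ x‖ ≤ C) (x : ℝ) :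
    ∫ t, bspline (n + 2) α t * ψ (x + t) =
      ∫ u, firstOrderSpline (α 0) u *
        ∫ v, bspline (n + 1) (Fin.tail α) v * ψ (x + u + v) := by
  have hint : Integrable (Function.uncurry fun t u : ℝ =>
      firstOrderSpline (α 0) u * bspline (n + 1) (Fin.tail α) (t - u) * ψ (x + t))
      (volume.prod volume) := by
    have h := (integrable_firstOrderSpline (α 0)).convolution_integrand
      (ContinuousLinearMap.mul ℂ ℂ) (integrable_bspline (n + 1) (Fin.tail α))
    exact h.mul_bdd (c := C) (Continuous.aestronglyMeasurable (by fun_prop))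
      (Filter.Eventually.of_forall fun p => hC _)
  have h1 : ∀ t, bspline (n + 2) α t * ψ (x + t) =
      ∫ u, firstOrderSpline (α 0) u * bspline (n + 1) (Fin.tail α) (t - u) * ψ (x + t) := by
    intro t
    rw [integral_mul_const]
    rfl
  simp only [h1]
  rw [integral_integral_swap hint]
  refine integral_congr_ae (Filter.Eventually.of_forall fun u => ?_)
  dsimp only
  simp only [mul_assoc]
  rw [integral_const_mul, ← integral_sub_right_eq_self
    (fun v => bspline (n + 1) (Fin.tail α) v * ψ (x + u + v)) u]
  congr 2
  funext t
  congr 2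
  ring

theorem tendsto_boxAverage (n : ℕ) (α : Fin (n + 1) → ℂ) {ψ : ℝ → ℂ} (hψ : Continuous ψ)
    {C : ℝ} (hC : ∀ x, ‖ψ x‖ ≤ C) {s : ℕ → ℕ} (hs : Filter.Tendsto s Filter.atTop Filter.atTop)
    (y : ℕ → ℝ) (x : ℝ) (hy : Filter.Tendsto y Filter.atTop (nhds x)) :
    Filter.Tendsto (fun p => boxAverage (s p) α ψ (y p)) Filter.atTop
      (nhds (∫ t, bspline (n + 1) α t * ψ (x + t))) := by
  induction n generalizing y x with
  | zero =>
    simp only [boxAverage_succ, boxAverage_zero]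
    exact tendsto_riemannSum (α 0) hs (fun _ => ψ) ψ C (fun _ => hC)
      (fun z w hz => (hψ.tendsto w).comp hz) y x hy
  | succ n ih =>
    simp only [boxAverage_succ (n := n + 1)]
    rw [integral_bspline_succ_mul α hψ hC]
    exact tendsto_riemannSum (α 0) hs (fun p => boxAverage (s p) (Fin.tail α) ψ)
      (fun w => ∫ v, bspline (n + 1) (Fin.tail α) v * ψ (w + v)) _
      (fun p w => norm_boxAverage_le _ _ _ _ C fun _ _ => hC _) (ih (Fin.tail α)) y x hy

theorem bspline_eq_zero : ∀ (n : ℕ) (α : Fin n → ℂ) {t : ℝ}, t ∉ Set.Icc (0 : ℝ) n →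
    bspline n α t = 0
  | 0, _, _, _ => rfl
  | 1, α, t, ht => by
    have ht' : t ∉ Set.Ico (0 : ℝ) 1 := fun h =>
      ht (by rw [Nat.cast_one]; exact Set.Ico_subset_Icc_self h)
    exact Set.indicator_of_notMem ht' fun t : ℝ => Complex.exp (α 0 * t)
  | n + 2, α, t, ht => by
    by_contra h
    have hmem : t ∈ Function.support (convolution (firstOrderSpline (α 0))
        (bspline (n + 1) (Fin.tail α)) (ContinuousLinearMap.mul ℂ ℂ) volume) := h
    obtain ⟨u, hu, v, hv, rfl⟩ := Set.mem_add.1 (support_convolution_subset _ hmem)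
    have hu' : u ∈ Set.Icc (0 : ℝ) 1 :=
      Set.Ico_subset_Icc_self (not_imp_comm.1 (fun h2 => Set.indicator_of_notMem h2 _) hu)
    have hv' : v ∈ Set.Icc (0 : ℝ) ((n + 1 : ℕ) : ℝ) := by
      by_contra hv'
      exact hv (bspline_eq_zero (n + 1) _ hv')
    refine ht ⟨add_nonneg hu'.1 hv'.1, ?_⟩
    have h1 := hu'.2
    have h2 := hv'.2
    push_cast at h2 ⊢
    linarith

/-! ### Splines with half-integer shifts -/

/-- The spline `∑_l b[l] β⁺_α(t - l/2)`. -/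
def splineSeries {n : ℕ} (α : Fin n → ℂ) (b : ℤ → ℂ) (t : ℝ) : ℂ :=
  ∑' l : ℤ, b l * bspline n α (t - (l : ℝ) / 2)

theorem bspline_sub_eq_zero {n : ℕ} (α : Fin n → ℂ) (t : ℝ) {l : ℤ}
    (hl : l ∉ Finset.Icc (⌊2 * (t - n)⌋) ⌈2 * t⌉) : bspline n α (t - (l : ℝ) / 2) = 0 := by
  refine bspline_eq_zero n α fun h => hl (Finset.mem_Icc.2 ⟨?_, ?_⟩)
  · have h1 : ((⌊2 * (t - n)⌋ : ℤ) : ℝ) ≤ (l : ℝ) := by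
      have := Int.floor_le (2 * (t - n))
      have := h.2
      linarith
    exact_mod_cast h1
  · have h1 : (l : ℝ) ≤ ((⌈2 * t⌉ : ℤ) : ℝ) := by
      have := Int.le_ceil (2 * t)
      have := h.1
      linarith
    exact_mod_cast h1

theorem hasSum_splineSeries {n : ℕ} (α : Fin n → ℂ) (b : ℤ → ℂ) (t : ℝ) :
    HasSum (fun l : ℤ => b l * bspline n α (t - (l : ℝ) / 2)) (splineSeries α b t) :=
  (summable_of_ne_finset_zero (s := Finset.Icc (⌊2 * (t - n)⌋) ⌈2 * t⌉) fun l hl => by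
    rw [bspline_sub_eq_zero α t hl, mul_zero]).hasSum

/-- The sum of a series of integrable functions with summable `L¹` norms is integrable. -/
theorem integrable_of_hasSum {F : ℤ → ℝ → ℂ} {f : ℝ → ℂ} (hF : ∀ l, Integrable (F l))
    (hsum : Summable fun l => ∫ t, ‖F l t‖) (hf : ∀ t, HasSum (fun l => F l t) (f t)) :
    Integrable f := by
  refine ⟨aestronglyMeasurable_of_tendsto_ae (u := Filter.atTop)
    (f := fun (S : Finset ℤ) t => ∑ l ∈ S, F l t)
    (fun S => Finset.aestronglyMeasurable_fun_sum S fun l _ => (hF l).1)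
    (Filter.Eventually.of_forall fun t => hf t), ?_⟩
  rw [hasFiniteIntegral_iff_enorm]
  calc ∫⁻ t, ‖f t‖ₑ ≤ ∫⁻ t, ∑' l, ‖F l t‖ₑ := lintegral_mono fun t => by
        rw [← (hf t).tsum_eq]
        exact enorm_tsum_le_tsum_enorm
    _ = ∑' l, ∫⁻ t, ‖F l t‖ₑ := lintegral_tsum fun l => (hF l).1.enorm
    _ = ∑' l, ENNReal.ofReal (∫ t, ‖F l t‖) := tsum_congr fun l => by
        rw [ofReal_integral_norm_eq_lintegral_enorm (hF l)]
    _ < ⊤ := hsum.tsum_ofReal_lt_top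

/-- Pairing a spline with a test function term by term. The bounds `D l` control the test function
on the support of the `l`-th shift. -/
theorem integrable_and_integral_splineSeries_mul {n : ℕ} (α : Fin n → ℂ) (b : ℤ → ℂ) {ψ : ℝ → ℂ}
    (hψ : Continuous ψ) {D : ℤ → ℝ}
    (hD : ∀ l : ℤ, ∀ y ∈ Set.Icc (0 : ℝ) n, ‖ψ ((l : ℝ) / 2 + y)‖ ≤ D l)
    (hbD : Summable fun l => ‖b l‖ * D l) :
    Integrable (fun t => splineSeries α b t * ψ t) ∧
      ∫ t, splineSeries α b t * ψ t =
        ∑' l : ℤ, b l * ∫ t, bspline n α t * ψ ((l : ℝ) / 2 + t) := by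
  have hbound : ∀ (l : ℤ) (t : ℝ), ‖b l * bspline n α (t - (l : ℝ) / 2) * ψ t‖ ≤
      ‖b l‖ * D l * ‖bspline n α (t - (l : ℝ) / 2)‖ := by
    intro l t
    by_cases ht : t - (l : ℝ) / 2 ∈ Set.Icc (0 : ℝ) n
    · have h := hD l _ ht
      rw [add_sub_cancel] at h
      rw [norm_mul, norm_mul, mul_right_comm]
      gcongr
    · simp [bspline_eq_zero n α ht]
  have hβ : ∀ l : ℤ, Integrable fun t => bspline n α (t - (l : ℝ) / 2) := fun l =>
    (integrable_bspline n α).comp_sub_right _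
  have hF : ∀ l : ℤ, Integrable fun t => b l * bspline n α (t - (l : ℝ) / 2) * ψ t := fun l =>
    Integrable.mono' ((hβ l).norm.const_mul (‖b l‖ * D l))
      (((hβ l).1.const_mul (b l)).mul hψ.aestronglyMeasurable)
      (Filter.Eventually.of_forall fun t => hbound l t)
  have hsum : Summable fun l : ℤ => ∫ t, ‖b l * bspline n α (t - (l : ℝ) / 2) * ψ t‖ := by
    refine Summable.of_nonneg_of_le (fun l => integral_nonneg fun t => norm_nonneg _) (fun l => ?_)
      (hbD.mul_right (∫ t, ‖bspline n α t‖))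
    refine (integral_mono (hF l).norm ((hβ l).norm.const_mul (‖b l‖ * D l)) (hbound l)).trans ?_
    rw [integral_const_mul, integral_sub_right_eq_self (fun t => ‖bspline n α t‖)]
  have hhas : ∀ t, HasSum (fun l : ℤ => b l * bspline n α (t - (l : ℝ) / 2) * ψ t)
      (splineSeries α b t * ψ t) := fun t => (hasSum_splineSeries α b t).mul_right _
  refine ⟨integrable_of_hasSum hF hsum hhas, ?_⟩
  have h := integral_tsum_of_summable_integral_norm hF hsum
  simp only [fun t => (hhas t).tsum_eq] at h
  rw [← h]
  refine tsum_congr fun l => ?_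
  simp only [mul_assoc]
  rw [integral_const_mul, ← integral_sub_right_eq_self
    (fun t => bspline n α t * ψ ((l : ℝ) / 2 + t)) ((l : ℝ) / 2)]
  simp only [add_sub_cancel]

/-- Pairing the comb of refined coefficients with `ψ` gives Riemann sums of `ψ` at the half
integers; the spacing of the coefficients `b`, upsampled by `u`, is `u / (2u) = 1/2`. -/
theorem hasSum_comb_boxFilter {n : ℕ} (α : Fin (n + 1) → ℂ) (b : ℤ → ℂ) {ψ : ℝ → ℂ} {D : ℤ → ℝ}
    (hD : ∀ l : ℤ, ∀ y ∈ Set.Icc (0 : ℝ) (n + 1 : ℕ), ‖ψ ((l : ℝ) / 2 + y)‖ ≤ D l)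
    (hbD : Summable fun l => ‖b l‖ * D l) {u : ℕ} (hu : 0 < u) :
    HasSum
      (fun k : ℤ => boxFilter (2 * u) (fun j => α j / (2 * u : ℕ)) (upsample u b) k *
        ((((2 * u : ℕ) : ℝ) : ℂ)⁻¹ * ψ ((k : ℝ) / (2 * u : ℕ))))
      (∑' l : ℤ, b l * boxAverage (2 * u) α ψ ((l : ℝ) / 2)) := by
  have hu' : (u : ℝ) ≠ 0 := by exact_mod_cast hu.ne'
  -- The box offsets, divided by `2u`, lie in `[0, n + 1]`, so that `D` bounds the shifts of `ψ`.
  have hs : ∀ i : Fin (n + 1) → Fin (2 * u),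
      Summable fun l : ℤ => b l * ψ ((l : ℝ) / 2 + (boxSum i : ℝ) / (2 * u : ℕ)) := by
    intro i
    refine Summable.of_norm_bounded hbD fun l => ?_
    rw [norm_mul]
    refine mul_le_mul_of_nonneg_left (hD l _ ⟨?_, ?_⟩) (norm_nonneg _)
    · rw [boxSum]
      positivity
    · rw [boxSum]
      push_cast
      rw [Finset.sum_div]
      refine (Finset.sum_le_sum (g := fun _ => (1 : ℝ)) fun j _ => ?_).trans ?_
      · exact div_le_one_of_le₀ (by exact_mod_cast (i j).2.le) (by positivity)
      · simp
  have hterm : ∀ i : Fin (n + 1) → Fin (2 * u), HasSum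
      (fun k : ℤ => upsample u b (k - boxSum i) * ψ ((k : ℝ) / (2 * u : ℕ)))
      (∑' l : ℤ, b l * ψ ((l : ℝ) / 2 + (boxSum i : ℝ) / (2 * u : ℕ))) := by
    intro i
    rw [← (Equiv.addRight (boxSum i)).hasSum_iff]
    simp only [Function.comp_def, Equiv.coe_addRight, add_sub_cancel_right]
    rw [← (injective_natCast_mul hu).hasSum_iff]
    · refine (hs i).hasSum.congr_fun fun l => ?_
      simp only [Function.comp_def, upsample_mul_left hu]
      congr 2
      push_cast
      field_simp
    · intro l hl
      rw [Function.notMem_support.1 fun h => hl (support_upsample_subset u b h), zero_mul]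
  have h := hasSum_sum (s := Finset.univ) fun (i : Fin (n + 1) → Fin (2 * u)) _ =>
    (hterm i).mul_left (boxWeight (2 * u) (fun j => α j / (2 * u : ℕ)) i *
      (((2 * u : ℕ) : ℝ) : ℂ)⁻¹)
  have hval : ∑' l : ℤ, b l * boxAverage (2 * u) α ψ ((l : ℝ) / 2) =
      ∑ i : Fin (n + 1) → Fin (2 * u), boxWeight (2 * u) (fun j => α j / (2 * u : ℕ)) i *
        (((2 * u : ℕ) : ℝ) : ℂ)⁻¹ *
          ∑' l : ℤ, b l * ψ ((l : ℝ) / 2 + (boxSum i : ℝ) / (2 * u : ℕ)) := by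
    simp only [← tsum_mul_left]
    rw [← Summable.tsum_finsetSum fun i _ => (hs i).mul_left _]
    refine tsum_congr fun l => ?_
    rw [boxAverage, Finset.mul_sum, Finset.mul_sum]
    refine Finset.sum_congr rfl fun i _ => ?_
    have h1 : ∀ j, α j / ((2 * u : ℕ) : ℂ) * ((i j : ℕ) : ℂ) =
        α j * (((i j : ℕ) / ((2 * u : ℕ) : ℝ) : ℝ) : ℂ) := by
      intro j
      push_cast
      ring
    simp only [boxWeight, h1, Nat.add_sub_cancel]
    rw [Complex.ofReal_natCast, pow_succ]
    ring
  rw [hval]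
  refine h.congr_fun fun k => ?_
  rw [boxFilter, Finset.sum_mul]
  exact Finset.sum_congr rfl fun i _ => by ring

/-- The combs of the refined coefficients converge to the spline, for one test function. -/
theorem tendsto_combPairing_boxFilter {n : ℕ} (α : Fin (n + 1) → ℂ) (b : ℤ → ℂ) {ψ : ℝ → ℂ}
    (hψ : Continuous ψ) {C : ℝ} (hC : ∀ x, ‖ψ x‖ ≤ C) {D : ℤ → ℝ}
    (hD : ∀ l : ℤ, ∀ y ∈ Set.Icc (0 : ℝ) (n + 1 : ℕ), ‖ψ ((l : ℝ) / 2 + y)‖ ≤ D l)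
    (hbD : Summable fun l => ‖b l‖ * D l) {u : ℕ → ℕ} (hu : ∀ p, 0 < u p)
    (hu' : Filter.Tendsto u Filter.atTop Filter.atTop) :
    Filter.Tendsto
      (fun p => combPairing (2 * u p : ℕ)
        (boxFilter (2 * u p) (fun j => α j / (2 * u p : ℕ)) (upsample (u p) b)) ψ)
      Filter.atTop (nhds (∫ t, splineSeries α b t * ψ t)) := by
  rw [(integrable_and_integral_splineSeries_mul α b hψ hD hbD).2]
  simp only [combPairing, (hasSum_comb_boxFilter α b hD hbD (hu _)).tsum_eq]
  have h2u : Filter.Tendsto (fun p => 2 * u p) Filter.atTop Filter.atTop :=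
    Filter.tendsto_atTop_mono (fun p => by omega) hu'
  refine tendsto_tsum_of_dominated_convergence (hbD.mul_left (Real.exp (∑ j, ‖α j‖)))
    (fun l => (tendsto_boxAverage n α hψ hC h2u _ _ tendsto_const_nhds).const_mul _)
    (Filter.Eventually.of_forall fun p l => ?_)
  rw [norm_mul, mul_left_comm]
  exact mul_le_mul_of_nonneg_left (norm_boxAverage_le _ _ _ _ _ (hD l)) (norm_nonneg _)

/-! ### Bounds for the test functions -/

/-- A compactly supported function has a finitely supported bound on the windows
`[l/2, l/2 + n]`. -/
theorem exists_bound_of_hasCompactSupport {ψ : ℝ → ℂ} (hψ : Continuous ψ)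
    (hψc : HasCompactSupport ψ) (n : ℕ) (b : ℤ → ℂ) :
    ∃ D : ℤ → ℝ, (∀ l : ℤ, ∀ y ∈ Set.Icc (0 : ℝ) n, ‖ψ ((l : ℝ) / 2 + y)‖ ≤ D l) ∧
      Summable fun l => ‖b l‖ * D l := by
  obtain ⟨C, hC⟩ := hψ.bounded_above_of_compact_support hψc
  obtain ⟨R, hR⟩ := hψc.isCompact.isBounded.subset_closedBall (0 : ℝ)
  set L : ℤ := ⌈2 * (R + n)⌉
  refine ⟨fun l => if l ∈ Finset.Icc (-L) L then C else 0, fun l y hy => ?_, ?_⟩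
  · dsimp only
    split_ifs with h
    · exact hC _
    · rw [norm_le_zero_iff]
      by_contra h1
      have h2 := hR (subset_tsupport ψ h1)
      rw [Metric.mem_closedBall, dist_zero_right, Real.norm_eq_abs, abs_le] at h2
      refine h (Finset.mem_Icc.2 ?_)
      have hL : 2 * (R + n) ≤ (L : ℝ) := Int.le_ceil _
      have hn : (0 : ℝ) ≤ n := Nat.cast_nonneg n
      constructor
      · have h3 : -(L : ℝ) ≤ l := by linarith [h2.1, hy.2]
        exact_mod_cast h3
      · have h3 : (l : ℝ) ≤ L := by linarith [h2.2, hy.1]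
        exact_mod_cast h3
  · exact summable_of_ne_finset_zero (s := Finset.Icc (-L) L) fun l hl => by
      simp only [if_neg hl, mul_zero]

theorem summable_one_div_one_add_abs_sq :
    Summable fun l : ℤ => 1 / (1 + |(l : ℝ)|) ^ 2 := by
  refine Summable.of_nonneg_of_le (fun l => by positivity) (fun l => ?_)
    ((Real.summable_one_div_int_add_rpow (1 / 2) 2).2 one_lt_two)
  have h0 : (l : ℝ) + 1 / 2 ≠ 0 := by
    intro h
    have h1 : ((2 * l + 1 : ℤ) : ℝ) = 0 := by push_cast; linarith
    have h2 : 2 * l + 1 = 0 := by exact_mod_cast h1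
    omega
  have h1 : |(l : ℝ) + 1 / 2| ≤ 1 + |(l : ℝ)| := by
    refine (abs_add_le _ _).trans ?_
    rw [abs_of_pos (one_half_pos (α := ℝ))]
    linarith
  rw [Real.rpow_two]
  have := abs_pos.2 h0
  gcongr

/-- Against coefficients of polynomial growth, the rapid decay of a Schwartz function gives a
summable bound on the windows `[l/2, l/2 + n]`. -/
theorem exists_bound_of_schwartzMap (ψ : SchwartzMap ℝ ℂ) (n : ℕ) {b : ℤ → ℂ} {C : ℝ} {N : ℕ}
    (hb : ∀ l : ℤ, ‖b l‖ ≤ C * (1 + |(l : ℝ)|) ^ N) :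
    ∃ D : ℤ → ℝ, (∀ l : ℤ, ∀ y ∈ Set.Icc (0 : ℝ) n, ‖ψ ((l : ℝ) / 2 + y)‖ ≤ D l) ∧
      Summable fun l => ‖b l‖ * D l := by
  obtain ⟨K, hK⟩ : ∃ K : ℝ, ∀ x : ℝ, (1 + ‖x‖) ^ (N + 2) * ‖ψ x‖ ≤ K :=
    ⟨_, fun x => by
      simpa using SchwartzMap.one_add_le_sup_seminorm_apply (𝕜 := ℝ) (m := (N + 2, 0))
        (k := N + 2) (n := 0) le_rfl le_rfl ψ x⟩
  have hK0 : 0 ≤ K := (by positivity : (0 : ℝ) ≤ _).trans (hK 0)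
  set A : ℝ := 2 + 2 * n
  have hA : 0 ≤ A := by positivity
  refine ⟨fun l => K * A ^ (N + 2) / (1 + |(l : ℝ)|) ^ (N + 2), fun l y hy => ?_, ?_⟩
  · have hx : 1 + |(l : ℝ)| ≤ A * (1 + ‖(l : ℝ) / 2 + y‖) := by
      have h1 : |(l : ℝ)| ≤ 2 * ‖(l : ℝ) / 2 + y‖ + 2 * n := by
        have h2 : (l : ℝ) = 2 * ((l : ℝ) / 2 + y) - 2 * y := by ring
        calc |(l : ℝ)| = |2 * ((l : ℝ) / 2 + y) - 2 * y| := by rw [← h2]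
          _ ≤ |2 * ((l : ℝ) / 2 + y)| + |2 * y| := abs_sub _ _
          _ ≤ 2 * ‖(l : ℝ) / 2 + y‖ + 2 * n := by
            rw [abs_mul, abs_mul, abs_two, abs_of_nonneg hy.1, Real.norm_eq_abs]
            linarith [hy.2]
      have h3 : 0 ≤ (n : ℝ) * ‖(l : ℝ) / 2 + y‖ := by positivity
      simp only [A]
      nlinarith
    rw [le_div_iff₀ (by positivity)]
    calc ‖ψ ((l : ℝ) / 2 + y)‖ * (1 + |(l : ℝ)|) ^ (N + 2)
        ≤ ‖ψ ((l : ℝ) / 2 + y)‖ * (A * (1 + ‖(l : ℝ) / 2 + y‖)) ^ (N + 2) := by gcongr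
      _ = A ^ (N + 2) * ((1 + ‖(l : ℝ) / 2 + y‖) ^ (N + 2) * ‖ψ ((l : ℝ) / 2 + y)‖) := by
        rw [mul_pow]
        ring
      _ ≤ A ^ (N + 2) * K := by gcongr; exact hK _
      _ = K * A ^ (N + 2) := mul_comm _ _
  · refine Summable.of_nonneg_of_le (fun l => by positivity) (fun l => ?_)
      (summable_one_div_one_add_abs_sq.mul_left (C * (K * A ^ (N + 2))))
    refine (mul_le_mul_of_nonneg_right (hb l) (by positivity)).trans_eq ?_
    have h : (1 + |(l : ℝ)|) ≠ 0 := by positivity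
    rw [pow_add]
    field_simp
    ring

theorem locallyIntegrable_splineSeries {n : ℕ} (α : Fin n → ℂ) (b : ℤ → ℂ) :
    LocallyIntegrable (splineSeries α b) := by
  rw [locallyIntegrable_iff]
  intro K hK
  obtain ⟨χ, hχ, -, hχc, -⟩ :=
    exists_continuous_one_zero_of_isCompact hK isClosed_empty (Set.disjoint_empty K)
  have hψ : Continuous fun t => (χ t : ℂ) := Complex.continuous_ofReal.comp χ.continuous
  have hψc : HasCompactSupport fun t => (χ t : ℂ) := hχc.comp_left Complex.ofReal_zero
  obtain ⟨D, hD, hbD⟩ := exists_bound_of_hasCompactSupport hψ hψc n b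
  refine (integrable_and_integral_splineSeries_mul α b hψ hD hbD).1.integrableOn.congr_fun
    (fun t ht => ?_) hK.measurableSet
  have h1 : χ t = 1 := hχ ht
  simp [h1]

/-! ### Convergence of the scheme -/

/-- A series of integer shifts of the causal generator is a spline with half-integer shifts. -/
theorem tsum_causalGenerator {n : ℕ} (α : Fin n → ℂ) {lam a : ℤ → ℂ} (ha : Admissible lam a)
    (t : ℝ) :
    ∑' k : ℤ, a k * causalGenerator lam α (t - k) =
      splineSeries α (fun l => halfShiftCoeff lam a (l - ((n : ℤ) - 2))) t := by
  set S : Finset ℤ := Finset.Icc (⌊2 * (t - n)⌋) ⌈2 * t⌉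
  have hgen : ∀ k : ℤ, a k * causalGenerator lam α (t - k) =
      ∑ l ∈ S, a k * lam (l - ((n : ℤ) - 2) - 2 * k) * bspline n α (t - (l : ℝ) / 2) := by
    intro k
    rw [causalGenerator, generator, ← (Equiv.subRight (((n : ℤ) - 2) + 2 * k)).tsum_eq,
      tsum_eq_sum (s := S), Finset.mul_sum]
    · refine Finset.sum_congr rfl fun l _ => ?_
      rw [centeredBspline, mul_assoc, Equiv.subRight_apply, sub_sub l]
      congr 3
      push_cast
      ring
    · intro l hl
      rw [centeredBspline, Equiv.subRight_apply]
      convert mul_zero _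
      rw [← bspline_sub_eq_zero α t hl]
      congr 1
      push_cast
      ring
  have hs : ∀ j : ℤ, Summable fun k : ℤ => a k * lam (j - 2 * k) := fun j =>
    Summable.of_norm (by simpa only [norm_mul] using ha j)
  simp only [hgen]
  rw [Summable.tsum_finsetSum fun l _ => (hs _).mul_right _, splineSeries, tsum_eq_sum (s := S)]
  · exact Finset.sum_congr rfl fun l _ => tsum_mul_right
  · intro l hl
    rw [bspline_sub_eq_zero α t hl, mul_zero]

theorem norm_halfShiftCoeff_le {lam a : ℤ → ℂ} (ha : Admissible lam a) {C : ℝ} {N : ℕ}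
    (h : ∀ j : ℤ, ∑' k : ℤ, ‖a k‖ * ‖lam (j - 2 * k)‖ ≤ C * (1 + |(j : ℝ)|) ^ N) (c l : ℤ) :
    ‖halfShiftCoeff lam a (l - c)‖ ≤ C * (1 + |(c : ℝ)|) ^ N * (1 + |(l : ℝ)|) ^ N := by
  have hC : 0 ≤ C := by
    have h0 := (tsum_nonneg fun k => by positivity).trans (h 0)
    simpa using h0
  have h1 : ‖halfShiftCoeff lam a (l - c)‖ ≤ ∑' k : ℤ, ‖a k‖ * ‖lam (l - c - 2 * k)‖ := by
    simp only [← norm_mul]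
    exact norm_tsum_le_tsum_norm (by simpa only [norm_mul] using ha (l - c))
  refine (h1.trans (h (l - c))).trans ?_
  rw [mul_assoc, ← mul_pow]
  gcongr
  push_cast
  have h2 : |(l : ℝ) - c| ≤ |(l : ℝ)| + |(c : ℝ)| := abs_sub _ _
  have h3 : 0 ≤ |(l : ℝ)| * |(c : ℝ)| := by positivity
  nlinarith

theorem schemeConverges_of_eq_tsum {n₀ : ℕ} (hn₀ : 1 ≤ n₀) (α : Fin n₀ → ℂ) {lam : ℤ → ℂ}
    (hlam : Summable fun n : ℤ => ‖lam n‖) {m m₀ : ℕ} (hm : 2 ≤ m) (hm₀ : 0 < m₀)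
    (hm₀_even : Even m₀) {f : ℝ → ℂ} {a : ℤ → ℂ} (ha : Admissible lam a)
    (hf : ∀ t : ℝ, f t = ∑' k : ℤ, a k * causalGenerator lam α (t - k)) :
    SchemeConverges lam α m m₀ a f := by
  obtain ⟨n, rfl⟩ : ∃ n, n₀ = n + 1 := ⟨n₀ - 1, by omega⟩
  obtain ⟨q, rfl⟩ := hm₀_even
  rw [← two_mul]
  have hq : 0 < q := by omega
  set b : ℤ → ℂ := fun l => halfShiftCoeff lam a (l - (((n + 1 : ℕ) : ℤ) - 2)) with hb
  obtain rfl : f = splineSeries α b := funext fun t => (hf t).trans (tsum_causalGenerator α ha t)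
  have hu : ∀ p, 0 < q * m ^ p := fun p => by positivity
  have hu' : Filter.Tendsto (fun p => q * m ^ p) Filter.atTop Filter.atTop :=
    Filter.tendsto_atTop_mono (fun p => Nat.le_mul_of_pos_left _ hq)
      (tendsto_pow_atTop_atTop_of_one_lt hm)
  have hscheme := scheme_eq_boxFilter lam hlam α (by omega : 0 < m) hq a ha
  have hscale : ∀ p : ℕ, ((2 * q : ℕ) : ℝ) * (m : ℝ) ^ p = ((2 * (q * m ^ p) : ℕ) : ℝ) := by
    intro p
    push_cast
    ring
  refine ⟨⟨locallyIntegrable_splineSeries α b, fun ψ hψ hψc => ?_⟩, fun hslow ψ => ?_⟩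
  · obtain ⟨C, hC⟩ := hψ.continuous.bounded_above_of_compact_support hψc
    obtain ⟨D, hD, hbD⟩ := exists_bound_of_hasCompactSupport hψ.continuous hψc (n + 1) b
    simp only [hscheme, hscale]
    exact tendsto_combPairing_boxFilter α b hψ.continuous hC hD hbD hu hu'
  · obtain ⟨C, N, hslow⟩ := hslow
    obtain ⟨D, hD, hbD⟩ := exists_bound_of_schwartzMap ψ (n + 1) (b := b)
      (norm_halfShiftCoeff_le ha hslow _)
    simp only [hscheme, hscale]
    refine ⟨fun p => (hasSum_comb_boxFilter α b hD hbD (hu p)).summable,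
      (integrable_and_integral_splineSeries_mul α b ψ.continuous hD hbD).1, ?_⟩
    exact tendsto_combPairing_boxFilter α b ψ.continuous
      (fun x => ψ.toBoundedContinuousFunction.norm_coe_le_norm x) hD hbD hu hu'

/-- If the centered generator is interpolatory, the samples of the spline are its coefficients
delayed by `n₀ - 1`. -/
theorem sample_eq_of_interpolatory {n₀ : ℕ} (α : Fin n₀ → ℂ) {lam : ℤ → ℂ} {f : ℝ → ℂ}
    {a : ℤ → ℂ} (hf : ∀ t : ℝ, f t = ∑' k : ℤ, a k * causalGenerator lam α (t - k))
    (hφ : Interpolatory (generator lam α)) (k : ℤ) : f k = a (k - ((n₀ : ℤ) - 1)) := by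
  have h : ∀ l : ℤ, causalGenerator lam α ((k : ℝ) - l) =
      if k - ((n₀ : ℤ) - 1) - l = 0 then 1 else 0 := by
    intro l
    rw [← hφ, causalGenerator]
    congr 1
    push_cast
    ring
  rw [hf, tsum_eq_single (k - ((n₀ : ℤ) - 1))]
  · rw [h, if_pos (sub_self _), mul_one]
  · intro l hl
    rw [h, if_neg fun h1 => hl (sub_eq_zero.1 h1).symm, mul_zero]

end

end ExpSpline

open ExpSpline in
theorem proposition4 (n₀ : ℕ) (hn₀ : 1 ≤ n₀) (α : Fin n₀ → ℂ)
    (lam : ℤ → ℂ) (hlam : Summable fun n : ℤ => ‖lam n‖)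
    (m m₀ : ℕ) (hm : 2 ≤ m) (hm₀ : 0 < m₀) (hm₀_even : Even m₀)
    (f : ℝ → ℂ) (a : ℤ → ℂ) (ha : Admissible lam a)
    (hf : ∀ t : ℝ, f t = ∑' k : ℤ, a k * causalGenerator lam α (t - k)) :
    SchemeConverges lam α m m₀ a f ∧
    (Interpolatory (generator lam α) →
      (∀ c : ℤ → ℂ, (∀ k : ℤ, c k = f k) →
        SchemeConverges lam α m m₀ c (fun t => f (t - ((n₀ : ℝ) - 1)))) ∧
      (∀ c : ℤ → ℂ, (∀ k : ℤ, c k = f ((k : ℝ) + ((n₀ : ℝ) - 1))) →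
        SchemeConverges lam α m m₀ c f)) := by
  have hmain := schemeConverges_of_eq_tsum hn₀ α hlam hm hm₀ hm₀_even ha hf
  refine ⟨hmain, fun hφ => ⟨fun c hc => ?_, fun c hc => ?_⟩⟩
  · obtain rfl : c = fun k => a (k - ((n₀ : ℤ) - 1)) :=
      funext fun k => (hc k).trans (sample_eq_of_interpolatory α hf hφ k)
    refine schemeConverges_of_eq_tsum hn₀ α hlam hm hm₀ hm₀_even (fun j => ?_) fun t => ?_
    · rw [← (Equiv.addRight ((n₀ : ℤ) - 1)).summable_iff]
      refine (ha (j - 2 * ((n₀ : ℤ) - 1))).congr fun k => ?_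
      simp only [Function.comp_apply, Equiv.coe_addRight, add_sub_cancel_right]
      congr 3
      ring
    · rw [hf, ← (Equiv.subRight ((n₀ : ℤ) - 1)).tsum_eq]
      refine tsum_congr fun k => ?_
      rw [Equiv.subRight_apply]
      congr 2
      push_cast
      ring
  · obtain rfl : c = a := by
      funext k
      have h := sample_eq_of_interpolatory α hf hφ (k + ((n₀ : ℤ) - 1))
      rw [add_sub_cancel_right] at h
      rw [hc, ← h]
      push_cast
      rfl
    exact hmain
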